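/- All sets are finite; digraphs may have parallel arcs and loops, and an arc enters a vertex $v$ if its head is $v$ and its tail is not $v$. Let $D=(V\cup R,A)$ be a digraph whose vertex set is the union of two disjoint sets $V$ and $R$, where every $r\in R$ is a root of $D$, that is, no arc of $D$ enters $r$ (a root may have any number of outgoing arcs). Let $\mathcal M$ be a matroid on the ground set $R$ with rank function $r_{\mathcal M}$. For $X\subseteq V\cup R$ let $d^-_A(X)$ be the number of arcs of $D$ with tail outside $X$ and head in $X$, and let $N^-_D(X)$ be the set of vertices outside $X$ from which at least one arc of $D$ goes to a vertex of $X$. An $r$-arborescence is a digraph containing $r$ whose underlying graph is a tree, in which no arc enters $r$ and exactly one arc enters every other vertex. A matroid-based packing of arborescences in $(D,\mathcal M)$ is a family $\{B_r\}_{r\in R}$ of pairwise arc-disjoint subdigraphs of $D$ such that each $B_r$ is an $r$-arborescence and, for every $v\in V$, the set $\{r\in R: v\in V(B_r)\}$ is a basis of $\mathcal M$. Then there exists a matroid-based packing of arborescences in $(D,\mathcal M)$ if and only if $$d^-_A(X)\ \ge\ r_{\mathcal M}(R)-r_{\mathcal M}(X\cap R)$$ for all $X\subseteq V\cup R$ with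 $X\cap V\neq\emptyset$ and $X\cap R=N^-_D(X\cap V)\cap R$. -/

import Mathlib

/-- A directed graph with vertex type `W` and arc type `A`; parallel arcs (and loops) are allowed. -/
structure MultiDigraph (W A : Type*) where
  /-- the vertex that an arc leaves -/
  tail : A → W
  /-- the vertex that an arc points to -/
  head : A → W

namespace MultiDigraph

/-- The set of arcs entering `X`: tail outside `X`, head in `X`. -/
def inArcs {W A : Type*} (D : MultiDigraph W A) (X : Set W) : Set A :=
  {a | D.tail a ∉ X ∧ D.head a ∈ X}

/-- The in-degree `d⁻(X)`, the number of arcs entering `X`. -/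
noncomputable def inDegree {W A : Type*} (D : MultiDigraph W A) (X : Set W) : ℕ∞ :=
  (D.inArcs X).encard

/-- `N⁻(X)`: the vertices outside `X` from which at least one arc goes to `X`. -/
def inNeighbors {W A : Type*} (D : MultiDigraph W A) (X : Set W) : Set W :=
  {v | v ∉ X ∧ ∃ a, D.tail a = v ∧ D.head a ∈ X}

/-- A vertex is a root of `D` if no arc enters it. -/
def IsRoot {W A : Type*} (D : MultiDigraph W A) (r : W) : Prop :=
  D.inDegree {r} = 0

/-- A subdigraph: a set of vertices and a set of arcs all of whose ends are among the vertices. -/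
structure Subdigraph {W A : Type*} (D : MultiDigraph W A) where
  /-- the vertices of the subdigraph -/
  verts : Set W
  /-- the arcs of the subdigraph -/
  arcs : Set A
  /-- the tail of every arc is a vertex of the subdigraph -/
  tail_mem : ∀ a ∈ arcs, D.tail a ∈ verts
  /-- the head of every arc is a vertex of the subdigraph -/
  head_mem : ∀ a ∈ arcs, D.head a ∈ verts

/-- The underlying undirected graph of a subdigraph, on the vertices of the subdigraph. -/
def Subdigraph.underlying {W A : Type*} {D : MultiDigraph W A} (B : D.Subdigraph) :
    SimpleGraph B.verts where
  Adj u v := u ≠ v ∧ ∃ a ∈ B.arcs,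
    (D.tail a = u ∧ D.head a = v) ∨ (D.tail a = v ∧ D.head a = u)
  symm := ⟨fun _ _ h => ⟨h.1.symm, h.2.imp fun _ ha => ⟨ha.1, ha.2.symm⟩⟩⟩
  loopless := ⟨fun _ h => h.1 rfl⟩

/-- `B` is an `r`-arborescence: its underlying graph is a tree, no arc of `B` has head `r`, and
every other vertex of `B` is the head of exactly one arc of `B`. (For finite `B` the number of arcs
is thus the number of vertices minus one, i.e. the number of edges of the simple graph
`B.underlying`; hence `B` has no loops and no parallel or opposite arcs.) -/
def Subdigraph.IsArborescence {W A : Type*} {D : MultiDigraph W A} (B : D.Subdigraph)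
    (r : W) : Prop :=
  r ∈ B.verts ∧ B.underlying.IsTree ∧ (∀ a ∈ B.arcs, D.head a ≠ r) ∧
    ∀ v ∈ B.verts, v ≠ r → ∃! a, a ∈ B.arcs ∧ D.head a = v

/-- A matroid-based packing of arborescences: a family `(B r)` indexed by `r ∈ R` of pairwise
arc-disjoint arborescences, `B r` with root `r`, such that for every `v ∈ V` the set of the roots
`r ∈ R` for which `B r` contains `v` is a basis of `R` in the matroid `M`. -/
def IsMatroidBasedPacking {W A : Type*} (D : MultiDigraph W A) (V R : Set W) (M : Matroid W)
    (B : R → D.Subdigraph) : Prop :=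
  (∀ r : R, (B r).IsArborescence r) ∧
  (∀ r s : R, r ≠ s → Disjoint (B r).arcs (B s).arcs) ∧
  ∀ v ∈ V, M.IsBasis {r : W | ∃ h : r ∈ R, v ∈ (B ⟨r, h⟩).verts} R

end MultiDigraph

/-!
The cut condition is necessary because, for a vertex `v` of `X`, every root outside `X` of an
arborescence through `v` yields an arc entering `X` (`IsMatroidBasedPacking.eRk_le`).

For sufficiency the arborescences are grown greedily, one arc at a time, starting from the isolated
roots. At any moment let `U` be the set of unused arcs, let `F v` be the set of the roots whose
arborescences contain `v`, and write `F X` for the union of the sets `F v` with `v ∈ X`. Two things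
are kept true: `F v` is independent for `v ∈ V`, and the number of arcs of `U` entering `X` plus the
rank of `F X` (`cutRank`) is at least the rank of `R`, for every `X` meeting `V`. At the start the
latter is the given condition, which extends from the special sets `X` of the statement to all sets
meeting `V` (`eRk_le_of_forall_inNeighbors`).

Suppose first that `F (tail a)` is contained in the span of `F (head a)` for every unused arc `a`.
No unused arc enters the set `Y` of the vertices from which a given `v ∈ V` can be reached along
unused arcs, so `F Y` spans `R`; since spans only grow along these arcs, already `F v` spans `R` and
is a basis (`le_encard_inArcs_add_eRk`).

Otherwise an unused arc `a` and a root `s` in `F (tail a)` outside the span of `F (head a)` are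
needed such that `a` may be added to the arborescence of `s`. The invariant can only fail for a tight
set `X` that `a` enters and whose `F X` spans `s`. Suppose that every choice is obstructed in this
way. Tight sets are closed under union and intersection, so one tight set obstructs `a` for all `s`
at once. Take such an obstructing set `X` minimal over all choices of `a`. By the argument of the
previous paragraph applied within `X`, there is a further arc inside `X` that increases the span, and
intersecting `X` with a tight set obstructing that arc contradicts minimality; this uses that what
is spanned by two tight sets is spanned by their intersection (`tight_inter_union`,
`exists_augmenting_arc`).
-/

namespace MultiDigraph

open Set

variable {W A : Type*} {D : MultiDigraph W A}

/-! ### Arborescences through directed reachability -/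

/-- One step along an arc of `B`. -/
def Subdigraph.Step (B : D.Subdigraph) (u v : W) : Prop :=
  ∃ a ∈ B.arcs, D.tail a = u ∧ D.head a = v

/-- `B` is an arborescence with root `r`, expressed by reachability: no arc of `B` has head `r`,
every other vertex is the head of exactly one arc, and every vertex can be reached from `r`. -/
structure Subdigraph.IsOutBranching (B : D.Subdigraph) (r : W) : Prop where
  root_mem : r ∈ B.verts
  head_ne : ∀ a ∈ B.arcs, D.head a ≠ r
  existsUnique : ∀ v ∈ B.verts, v ≠ r → ∃! a, a ∈ B.arcs ∧ D.head a = v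
  reachable : ∀ v ∈ B.verts, Relation.ReflTransGen B.Step r v

/-- Reachability makes the underlying graph connected, and sending each edge to the head of an arc
over it injects the edges into the vertices other than `r`, so the edge count forces a tree. -/
lemma Subdigraph.IsOutBranching.isArborescence [Finite W] {B : D.Subdigraph} {r : W}
    (h : B.IsOutBranching r) : B.IsArborescence r := by
  refine ⟨h.root_mem, ?_, h.head_ne, h.existsUnique⟩
  have hreach : ∀ v, Relation.ReflTransGen B.Step r v →
      ∀ hv : v ∈ B.verts, B.underlying.Reachable ⟨r, h.root_mem⟩ ⟨v, hv⟩ := by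
    intro v hrv
    induction hrv with
    | refl => intro _; exact SimpleGraph.Reachable.refl _
    | @tail u v _ huv ih =>
      intro hv
      obtain ⟨a, ha, rfl, rfl⟩ := huv
      refine (ih (B.tail_mem a ha)).trans ?_
      by_cases hne : D.tail a = D.head a
      · simp only [hne]; exact SimpleGraph.Reachable.refl _
      · refine SimpleGraph.Adj.reachable ⟨fun h' => hne (congrArg Subtype.val h'), a, ha, ?_⟩
        exact Or.inl ⟨rfl, rfl⟩
  have hconn : B.underlying.Connected := by
    have : Nonempty B.verts := ⟨⟨r, h.root_mem⟩⟩
    refine SimpleGraph.Connected.mk fun u v => ?_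
    exact (hreach u (h.reachable u u.2) u.2).symm.trans (hreach v (h.reachable v v.2) v.2)
  refine SimpleGraph.isTree_iff_connected_and_card.2
    ⟨hconn, le_antisymm ?_ hconn.card_vert_le_card_edgeSet_add_one⟩
  have harc : ∀ e : B.underlying.edgeSet, ∃ a : A, ∃ ha : a ∈ B.arcs,
      e.1 = s(⟨D.tail a, B.tail_mem a ha⟩, ⟨D.head a, B.head_mem a ha⟩) := by
    rintro ⟨e, he⟩
    induction e using Sym2.ind with
    | _ u v =>
      obtain ⟨-, a, ha, h1 | h1⟩ := (SimpleGraph.mem_edgeSet _).1 he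
      · exact ⟨a, ha, Sym2.eq_iff.2 (Or.inl ⟨Subtype.ext h1.1.symm, Subtype.ext h1.2.symm⟩)⟩
      · exact ⟨a, ha, Sym2.eq_iff.2 (Or.inr ⟨Subtype.ext h1.2.symm, Subtype.ext h1.1.symm⟩)⟩
  choose f hf hfe using harc
  let g : B.underlying.edgeSet → {v : B.verts // v ≠ ⟨r, h.root_mem⟩} := fun e =>
    ⟨⟨D.head (f e), B.head_mem _ (hf e)⟩,
      fun h' => h.head_ne _ (hf e) (congrArg Subtype.val h')⟩
  have hg : Function.Injective g := by
    intro e e' hee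
    have h1 : D.head (f e) = D.head (f e') := congrArg (fun x => x.1.1) hee
    have h2 : f e = f e' :=
      (h.existsUnique _ (B.head_mem _ (hf e)) (h.head_ne _ (hf e))).unique
        ⟨hf e, rfl⟩ ⟨hf e', h1.symm⟩
    apply Subtype.ext
    rw [hfe e, hfe e']
    simp only [h2]
  have hcard := Nat.card_le_card_of_injective g hg
  have hlt : Nat.card {v : B.verts // v ≠ ⟨r, h.root_mem⟩} < Nat.card B.verts :=
    Finite.card_subtype_lt (x := ⟨r, h.root_mem⟩) (by simp)
  omega

/-- The vertices reachable from the root are closed under adjacency in the underlying graph: an arc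
entering a reachable vertex `v ≠ r` is the last arc of a directed path from `r` to `v`. -/
lemma Subdigraph.IsArborescence.isOutBranching {B : D.Subdigraph} {r : W}
    (h : B.IsArborescence r) : B.IsOutBranching r := by
  obtain ⟨hr, htree, hhead, huniq⟩ := h
  refine ⟨hr, hhead, huniq, fun v hv => ?_⟩
  obtain ⟨p⟩ := htree.connected.preconnected ⟨r, hr⟩ ⟨v, hv⟩
  have key : ∀ (x y : B.verts), B.underlying.Walk x y →
      Relation.ReflTransGen B.Step r x → Relation.ReflTransGen B.Step r y := by
    intro x y p
    induction p with
    | nil => exact id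
    | @cons x y z hxy _ ih =>
      intro hx
      refine ih ?_
      obtain ⟨-, a, ha, h1 | h1⟩ := hxy
      · exact hx.tail ⟨a, ha, h1⟩
      · rcases Relation.ReflTransGen.cases_tail hx with h2 | ⟨w, hw, b, hb, hbw, hbx⟩
        · exact absurd (h1.2.trans h2) (hhead a ha)
        · have hxr : (x : W) ≠ r := fun h' => hhead a ha (h1.2.trans h')
          have hab : a = b := (huniq x x.2 hxr).unique ⟨ha, h1.2⟩ ⟨hb, hbx⟩
          have hwy : w = y := by rw [← hbw, ← h1.1, hab]
          exact hwy ▸ hw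
  exact key _ _ p Relation.ReflTransGen.refl

/-- A path from outside `X` into `X` uses an arc entering `X`. -/
lemma Subdigraph.exists_mem_inArcs {B : D.Subdigraph} {r v : W} {X : Set W}
    (h : Relation.ReflTransGen B.Step r v) (hr : r ∉ X) (hv : v ∈ X) :
    ∃ a ∈ B.arcs, a ∈ D.inArcs X := by
  induction h with
  | refl => exact absurd hv hr
  | @tail u v _ huv ih =>
    by_cases hu : u ∈ X
    · exact ih hu
    · obtain ⟨a, ha, rfl, rfl⟩ := huv
      exact ⟨a, ha, hu, hv⟩

/-- The subdigraph consisting of the single vertex `r`. -/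
def Subdigraph.point (D : MultiDigraph W A) (r : W) : D.Subdigraph where
  verts := {r}
  arcs := ∅
  tail_mem := by simp
  head_mem := by simp

lemma Subdigraph.isOutBranching_point (D : MultiDigraph W A) (r : W) :
    (Subdigraph.point D r).IsOutBranching r where
  root_mem := rfl
  head_ne := by simp [point]
  existsUnique := by rintro v rfl h; exact absurd rfl h
  reachable := by rintro v rfl; exact Relation.ReflTransGen.refl

/-- The subdigraph `B` with an arc leaving one of its vertices, and the head of that arc, added. -/
def Subdigraph.addArc (B : D.Subdigraph) (a : A) (ha : D.tail a ∈ B.verts) : D.Subdigraph where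
  verts := insert (D.head a) B.verts
  arcs := insert a B.arcs
  tail_mem := by
    rintro b (rfl | hb)
    · exact Or.inr ha
    · exact Or.inr (B.tail_mem b hb)
  head_mem := by
    rintro b (rfl | hb)
    · exact Or.inl rfl
    · exact Or.inr (B.head_mem b hb)

lemma Subdigraph.IsOutBranching.addArc {B : D.Subdigraph} {r : W} (h : B.IsOutBranching r)
    {a : A} (ha : D.tail a ∈ B.verts) (hna : D.head a ∉ B.verts) :
    (B.addArc a ha).IsOutBranching r where
  root_mem := Or.inr h.root_mem
  head_ne := by
    rintro b (rfl | hb)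
    · exact fun h' => hna (h' ▸ h.root_mem)
    · exact h.head_ne b hb
  existsUnique := by
    rintro v (rfl | hv) hvr
    · refine ⟨a, ⟨Or.inl rfl, rfl⟩, ?_⟩
      rintro b ⟨rfl | hb, hbv⟩
      · rfl
      · exact absurd (hbv ▸ B.head_mem b hb) hna
    · obtain ⟨b, ⟨hb, hbv⟩, hb'⟩ := h.existsUnique v hv hvr
      refine ⟨b, ⟨Or.inr hb, hbv⟩, ?_⟩
      rintro c ⟨rfl | hc, hcv⟩
      · exact absurd (hcv ▸ hv) hna
      · exact hb' c ⟨hc, hcv⟩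
  reachable := by
    have hmono : ∀ v, Relation.ReflTransGen B.Step r v →
        Relation.ReflTransGen (B.addArc a ha).Step r v := fun v hv =>
      Relation.ReflTransGen.mono (fun _ _ ⟨b, hb, h'⟩ => ⟨b, Or.inr hb, h'⟩) _ _ hv
    rintro v (rfl | hv)
    · exact (hmono _ (h.reachable _ ha)).tail ⟨a, Or.inl rfl, rfl, rfl⟩
    · exact hmono _ (h.reachable v hv)

/-! ### The cut function and its tight sets -/

/-- The number of arcs of `U` entering `X` plus the rank of the union of the sets `F v`, `v ∈ X`. -/
noncomputable def cutRank (D : MultiDigraph W A) (M : Matroid W) (F : W → Set W) (U : Set A)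
    (X : Set W) : ℕ∞ :=
  (D.inArcs X ∩ U).encard + M.eRk (⋃ v ∈ X, F v)

lemma encard_inArcs_inter_add_union_le (D : MultiDigraph W A) (U : Set A) (X Y : Set W) :
    (D.inArcs (X ∩ Y) ∩ U).encard + (D.inArcs (X ∪ Y) ∩ U).encard ≤
      (D.inArcs X ∩ U).encard + (D.inArcs Y ∩ U).encard := by
  rw [← encard_union_add_encard_inter (D.inArcs (X ∩ Y) ∩ U),
    ← encard_union_add_encard_inter (D.inArcs X ∩ U)]
  refine add_le_add (encard_le_encard ?_) (encard_le_encard ?_) <;> intro a <;>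
    simp only [inArcs, mem_union, mem_inter_iff, mem_ofPred_eq] <;> tauto

section Tight

variable {M : Matroid W} {F : W → Set W} {U : Set A} {V : Set W} {k : ℕ∞}

/-- If `F` does not grow in span against the arcs of `U` inside `X`, then the vertices of `X` from
which `v` can be reached inside `X` span no more than `F v`, and no arc from the rest of `X` enters
them. -/
lemma le_encard_inArcs_add_eRk (hF : ∀ v, F v ⊆ M.E)
    (hk : ∀ X : Set W, (X ∩ V).Nonempty → k ≤ D.cutRank M F U X) {X : Set W}
    (hX : ∀ a ∈ U, D.tail a ∈ X → D.head a ∈ X → F (D.tail a) ⊆ M.closure (F (D.head a)))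
    {v : W} (hvX : v ∈ X) (hvV : v ∈ V) :
    k ≤ (D.inArcs X ∩ U).encard + M.eRk (F v) := by
  let S : W → W → Prop := fun x y => ∃ a ∈ U, D.tail a = x ∧ D.head a = y ∧ x ∈ X ∧ y ∈ X
  let Y : Set W := {w | Relation.ReflTransGen S w v}
  have hYX : Y ⊆ X := by
    intro w hw
    rcases Relation.ReflTransGen.cases_head hw with rfl | ⟨_, ⟨_, _, _, _, h, _⟩, _⟩
    · exact hvX
    · exact h
  have hspan : ∀ w ∈ Y, F w ⊆ M.closure (F v) := by
    intro w hw
    induction hw using Relation.ReflTransGen.head_induction_on with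
    | refl => exact M.subset_closure _ (hF v)
    | head h _ ih =>
      obtain ⟨a, ha, rfl, rfl, h1, h2⟩ := h
      exact (hX a ha h1 h2).trans (M.closure_subset_closure_of_subset_closure ih)
  refine (hk Y ⟨v, Relation.ReflTransGen.refl, hvV⟩).trans (add_le_add (encard_le_encard ?_) ?_)
  · rintro a ⟨⟨ht, hh⟩, haU⟩
    refine ⟨⟨fun htX => ht ?_, hYX hh⟩, haU⟩
    exact Relation.ReflTransGen.head ⟨a, haU, rfl, rfl, htX, hYX hh⟩ hh
  · rw [← M.eRk_closure_eq (F v)]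
    exact M.eRk_mono (iUnion₂_subset hspan)

variable [Finite W] [Finite A]

/-- Uncrossing two tight sets. Besides tightness of the intersection and the union, equality in the
submodular inequality applied to the *spans* shows that whatever is spanned by both sets is spanned
by their intersection. -/
lemma tight_inter_union (hF : ∀ v, F v ⊆ M.E)
    (hk : ∀ X : Set W, (X ∩ V).Nonempty → k ≤ D.cutRank M F U X) {X Y : Set W}
    (hXY : (X ∩ Y ∩ V).Nonempty) (hX : D.cutRank M F U X ≤ k) (hY : D.cutRank M F U Y ≤ k) :
    D.cutRank M F U (X ∩ Y) ≤ k ∧ D.cutRank M F U (X ∪ Y) ≤ k ∧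
      M.closure (⋃ v ∈ X, F v) ∩ M.closure (⋃ v ∈ Y, F v) ⊆ M.closure (⋃ v ∈ X ∩ Y, F v) := by
  have hE : ∀ Z : Set W, (⋃ v ∈ Z, F v) ⊆ M.E := fun Z => iUnion₂_subset fun v _ => hF v
  have hki := hk _ hXY
  have hku := hk (X ∪ Y) (hXY.mono (by intro x; simp only [mem_union, mem_inter_iff]; tauto))
  have hd := encard_inArcs_inter_add_union_le D U X Y
  have hr := M.eRk_inter_add_eRk_union_le (M.closure (⋃ v ∈ X, F v)) (M.closure (⋃ v ∈ Y, F v))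
  rw [M.eRk_closure_eq, M.eRk_closure_eq, M.eRk_union_closure_left_eq,
    M.eRk_union_closure_right_eq, ← biUnion_union] at hr
  have hsub : (⋃ v ∈ X ∩ Y, F v) ⊆ M.closure (⋃ v ∈ X, F v) ∩ M.closure (⋃ v ∈ Y, F v) :=
    subset_inter
      ((biUnion_subset_biUnion_left inter_subset_left).trans (M.subset_closure _ (hE X)))
      ((biUnion_subset_biUnion_left inter_subset_right).trans (M.subset_closure _ (hE Y)))
  have hm := M.eRk_mono hsub
  have hfin : ∀ Z : Set W, ∃ n : ℕ, M.eRk Z = n := fun Z =>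
    ENat.ne_top_iff_exists.1 (Matroid.eRk_ne_top_iff.2 (M.isRkFinite_of_finite Z.toFinite))
      |>.imp fun _ => Eq.symm
  have hfin' : ∀ Z : Set A, ∃ n : ℕ, Z.encard = n := fun Z =>
    ENat.ne_top_iff_exists.1 Z.toFinite.encard_lt_top.ne |>.imp fun _ => Eq.symm
  unfold cutRank at hX hY hki hku ⊢
  obtain ⟨r₁, h₁⟩ := hfin (⋃ v ∈ X, F v)
  obtain ⟨r₂, h₂⟩ := hfin (⋃ v ∈ Y, F v)
  obtain ⟨r₃, h₃⟩ := hfin (⋃ v ∈ X ∩ Y, F v)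
  obtain ⟨r₄, h₄⟩ := hfin (⋃ v ∈ X ∪ Y, F v)
  obtain ⟨r₅, h₅⟩ := hfin (M.closure (⋃ v ∈ X, F v) ∩ M.closure (⋃ v ∈ Y, F v))
  obtain ⟨d₁, e₁⟩ := hfin' (D.inArcs X ∩ U)
  obtain ⟨d₂, e₂⟩ := hfin' (D.inArcs Y ∩ U)
  obtain ⟨d₃, e₃⟩ := hfin' (D.inArcs (X ∩ Y) ∩ U)
  obtain ⟨d₄, e₄⟩ := hfin' (D.inArcs (X ∪ Y) ∩ U)
  have hcl : M.eRk (M.closure (⋃ v ∈ X, F v) ∩ M.closure (⋃ v ∈ Y, F v)) ≤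
      M.eRk (⋃ v ∈ X ∩ Y, F v) → M.closure (⋃ v ∈ X, F v) ∩ M.closure (⋃ v ∈ Y, F v) ⊆
        M.closure (⋃ v ∈ X ∩ Y, F v) := fun hle => by
    rw [(M.isRkFinite_of_finite (toFinite _)).closure_eq_closure_of_subset_of_eRk_ge_eRk hsub hle]
    exact M.subset_closure _ (inter_subset_left.trans (M.closure_subset_ground _))
  rw [h₁, e₁] at hX
  rw [h₂, e₂] at hY
  rw [h₃, e₃] at hki
  rw [h₄, e₄] at hku
  rw [h₁, h₂, h₄, h₅] at hr
  rw [h₃, h₅] at hm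
  rw [e₁, e₂, e₃, e₄] at hd
  lift k to ℕ using ne_top_of_le_ne_top (by simp) hki
  rw [h₃, e₃, h₄, e₄]
  norm_cast at *
  refine ⟨by omega, by omega, hcl ?_⟩
  rw [h₅, h₃]
  norm_cast
  omega

/-- If some arc of `U` leads out of the span, there are an arc `a` of `U` and an element `s` of
`F (tail a)` not spanned by `F (head a)` such that `s` is spanned by no tight set that `a` enters. -/
lemma exists_augmenting_arc (hF : ∀ v, F v ⊆ M.E)
    (hV : ∀ a, D.tail a ≠ D.head a → D.head a ∈ V)
    (hk : ∀ X : Set W, (X ∩ V).Nonempty → k ≤ D.cutRank M F U X)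
    (hgood : ∃ a ∈ U, ¬ F (D.tail a) ⊆ M.closure (F (D.head a))) :
    ∃ a ∈ U, ∃ s ∈ F (D.tail a), s ∉ M.closure (F (D.head a)) ∧
      ∀ X, D.head a ∈ X → D.tail a ∉ X → D.cutRank M F U X ≤ k →
        s ∉ M.closure (⋃ v ∈ X, F v) := by
  by_contra! hcon
  have hE : ∀ Z : Set W, (⋃ v ∈ Z, F v) ⊆ M.E := fun Z => iUnion₂_subset fun v _ => hF v
  have hhead : ∀ a, ¬ F (D.tail a) ⊆ M.closure (F (D.head a)) → D.head a ∈ V := by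
    intro a ha
    refine hV a fun h => ha ?_
    rw [h]
    exact M.subset_closure _ (hF _)
  -- The tight sets entered by `a` are closed under union, so the largest one spans all of
  -- `F (tail a)`.
  have hdom : ∀ a ∈ U, ¬ F (D.tail a) ⊆ M.closure (F (D.head a)) →
      ∃ X, D.head a ∈ X ∧ D.tail a ∉ X ∧ D.cutRank M F U X ≤ k ∧
        F (D.tail a) ⊆ M.closure (⋃ v ∈ X, F v) := by
    intro a ha hag
    obtain ⟨s₀, hs₀, hs₀'⟩ := not_subset.1 hag
    obtain ⟨X₀, h1, h2, h3, -⟩ := hcon a ha s₀ hs₀ hs₀'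
    obtain ⟨X, ⟨hX1, hX2, hX3⟩, hXmax⟩ := Set.Finite.exists_maximal
      (s := {X : Set W | D.head a ∈ X ∧ D.tail a ∉ X ∧ D.cutRank M F U X ≤ k})
      (toFinite _) ⟨X₀, h1, h2, h3⟩
    refine ⟨X, hX1, hX2, hX3, fun s hs => ?_⟩
    by_cases hs' : s ∈ M.closure (F (D.head a))
    · exact M.closure_subset_closure (subset_biUnion_of_mem (u := F) hX1) hs'
    obtain ⟨Y, hY1, hY2, hY3, hY4⟩ := hcon a ha s hs hs'
    have hu := (tight_inter_union hF hk ⟨_, ⟨hX1, hY1⟩, hhead a hag⟩ hX3 hY3).2.1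
    have hle : X ∪ Y ⊆ X := hXmax ⟨Or.inl hX1, by rintro (h | h) <;> contradiction, hu⟩
      subset_union_left
    exact M.closure_subset_closure
      (biUnion_subset_biUnion_left (subset_union_right.trans hle)) hY4
  obtain ⟨a₀, ha₀, hag₀⟩ := hgood
  obtain ⟨X₀, hX₀⟩ := hdom a₀ ha₀ hag₀
  obtain ⟨X, ⟨a, ha, hag, hX1, hX2, hX3, hX4⟩, hXmin⟩ := Set.Finite.exists_minimal
    (s := {X : Set W | ∃ a ∈ U, ¬ F (D.tail a) ⊆ M.closure (F (D.head a)) ∧ D.head a ∈ X ∧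
      D.tail a ∉ X ∧ D.cutRank M F U X ≤ k ∧ F (D.tail a) ⊆ M.closure (⋃ v ∈ X, F v)})
    (toFinite _) ⟨X₀, a₀, ha₀, hag₀, hX₀⟩
  -- Some arc inside `X` leads out of the span as well; otherwise `F (head a)` has full rank in `X`.
  obtain ⟨b, hb, hbt, hbh, hbg⟩ : ∃ b ∈ U, D.tail b ∈ X ∧ D.head b ∈ X ∧
      ¬ F (D.tail b) ⊆ M.closure (F (D.head b)) := by
    by_contra! hno
    have hle := hX3.trans (le_encard_inArcs_add_eRk hF hk hno hX1 (hhead a hag))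
    have hle' := (ENat.add_le_add_iff_left (toFinite _).encard_lt_top.ne).1 hle
    refine hag (hX4.trans ?_)
    rw [(M.isRkFinite_of_finite (toFinite _)).closure_eq_closure_of_subset_of_eRk_ge_eRk
      (subset_biUnion_of_mem (u := F) hX1) hle']
  -- A tight set for that arc cuts `X` down to a smaller tight set entered by it.
  obtain ⟨Y, hY1, hY2, hY3, hY4⟩ := hdom b hb hbg
  obtain ⟨hi, -, hcl⟩ := tight_inter_union hF hk ⟨_, ⟨hbh, hY1⟩, hhead b hbg⟩ hX3 hY3
  have hXY : X ⊆ X ∩ Y := hXmin ⟨b, hb, hbg, ⟨hbh, hY1⟩, fun h => hY2 h.2, hi, fun s hs =>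
    hcl ⟨M.subset_closure _ (hE X) (mem_biUnion hbt hs), hY4 hs⟩⟩ inter_subset_left
  exact hY2 (hXY hbt).2

end Tight

/-! ### Growing the arborescences -/

/-- The set of the indices `r ∈ R` for which `B r` contains `v`. -/
def rootsThrough {R : Set W} (B : R → D.Subdigraph) (v : W) : Set W :=
  {r : W | ∃ h : r ∈ R, v ∈ (B ⟨r, h⟩).verts}

/-- Adding the arc `a` to one of the arborescences as in `exists_augmenting_arc` preserves the cut
condition: the in-degree of `X` drops by one only if `a` enters `X`, and then either `X` was not
tight or its rank grows. -/
lemma le_cutRank_of_augment [Finite W] [Finite A] {M : Matroid W} {F F' : W → Set W} {U : Set A}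
    {k : ℕ∞} {X : Set W} {a : A} {s : W} (haU : a ∈ U) (hsE : s ∈ M.E)
    (hFF' : ∀ v, F v ⊆ F' v) (hs : s ∈ F' (D.head a))
    (hX : k ≤ D.cutRank M F U X)
    (hna : D.head a ∈ X → D.tail a ∉ X → D.cutRank M F U X ≤ k →
      s ∉ M.closure (⋃ v ∈ X, F v)) :
    k ≤ D.cutRank M F' (U \ {a}) X := by
  have hsub : (⋃ v ∈ X, F v) ⊆ ⋃ v ∈ X, F' v := iUnion₂_mono fun v _ => hFF' v
  by_cases haX : a ∈ D.inArcs X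
  · have hd : (D.inArcs X ∩ (U \ {a})).encard + 1 = (D.inArcs X ∩ U).encard := by
      rw [← inter_sdiff_assoc]
      exact encard_sdiff_singleton_add_one ⟨haX, haU⟩
    by_cases hlt : k < D.cutRank M F U X
    · refine Order.le_of_lt_add_one (hlt.trans_le ?_)
      rw [cutRank, cutRank, ← hd, add_right_comm]
      gcongr
      exact M.eRk_mono hsub
    · have hrk : M.eRk (⋃ v ∈ X, F v) + 1 ≤ M.eRk (⋃ v ∈ X, F' v) := by
        rw [← Matroid.eRk_insert_eq_add_one ⟨hsE, hna haX.2 haX.1 (not_lt.1 hlt)⟩]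
        exact M.eRk_mono (insert_subset (mem_biUnion haX.2 hs) hsub)
      refine hX.trans ?_
      rw [cutRank, cutRank, ← hd, add_assoc, add_comm 1]
      gcongr
  · refine hX.trans (add_le_add (encard_le_encard ?_) (M.eRk_mono hsub))
    rintro b ⟨hb, hbU⟩
    exact ⟨hb, hbU, by rintro rfl; exact haX hb⟩

/-- Arc-disjoint arborescences that use no arc of `U` and cover each vertex of `V` by an independent
set of roots extend to a matroid-based packing as long as the cut condition holds for `U`. -/
lemma exists_packing_of_partial [Finite W] [Finite A] {V R : Set W} {M : Matroid W}
    (hM : M.E = R) (hV : ∀ a, D.tail a ≠ D.head a → D.head a ∈ V) (U : Set A)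
    (B : R → D.Subdigraph) (hB : ∀ r : R, (B r).IsOutBranching r)
    (hdisj : ∀ r s : R, r ≠ s → Disjoint (B r).arcs (B s).arcs)
    (hU : ∀ r : R, Disjoint (B r).arcs U)
    (hind : ∀ v ∈ V, M.Indep (rootsThrough B v))
    (hk : ∀ X : Set W, (X ∩ V).Nonempty → M.eRk R ≤ D.cutRank M (rootsThrough B) U X) :
    ∃ B : R → D.Subdigraph, D.IsMatroidBasedPacking V R M B := by
  classical
  induction hn : U.ncard using Nat.strong_induction_on generalizing U B with
  | _ n ih =>
  subst hn
  have hR : ∀ v, rootsThrough B v ⊆ R := fun v r h => h.1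
  have hF : ∀ v, rootsThrough B v ⊆ M.E := hM ▸ hR
  by_cases hgood : ∃ a ∈ U, ¬ rootsThrough B (D.tail a) ⊆ M.closure (rootsThrough B (D.head a))
  · obtain ⟨a, haU, s, ⟨hsR, hsB⟩, hs, hnt⟩ := exists_augmenting_arc hF hV hk hgood
    have hsE : s ∈ M.E := hM ▸ hsR
    have hsn : s ∉ rootsThrough B (D.head a) := fun h => hs (M.mem_closure_of_mem h (hF _))
    have hsn' : D.head a ∉ (B ⟨s, hsR⟩).verts := fun h => hsn ⟨hsR, h⟩
    let B' : R → D.Subdigraph := Function.update B ⟨s, hsR⟩ ((B ⟨s, hsR⟩).addArc a hsB)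
    have hB's : B' ⟨s, hsR⟩ = (B ⟨s, hsR⟩).addArc a hsB := Function.update_self ..
    have hB'n : ∀ r, r ≠ ⟨s, hsR⟩ → B' r = B r := fun r hr => Function.update_of_ne hr ..
    have haB : ∀ r, a ∉ (B r).arcs := fun r h => (hU r).notMem_of_mem_left h haU
    have hmem : ∀ v r, r ∈ rootsThrough B' v ↔
        r ∈ rootsThrough B v ∨ (r = s ∧ v = D.head a) := by
      intro v r
      by_cases hrs : r = s
      · subst hrs
        simp only [rootsThrough, mem_ofPred_eq, hsR, exists_true_left, hB's, Subdigraph.addArc,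
          mem_insert_iff, true_and]
        tauto
      · have : ∀ h : r ∈ R, B' ⟨r, h⟩ = B ⟨r, h⟩ := fun h =>
          hB'n _ fun h' => hrs (congrArg Subtype.val h')
        simp [rootsThrough, this, hrs]
    refine ih (U \ {a}).ncard (ncard_sdiff_singleton_lt_of_mem haU) (U \ {a}) B' ?_ ?_ ?_ ?_ ?_ rfl
    · intro r
      by_cases hr : r = ⟨s, hsR⟩
      · subst hr; rw [hB's]; exact (hB _).addArc hsB hsn'
      · rw [hB'n r hr]; exact hB r
    · have h1 : ∀ r, r ≠ ⟨s, hsR⟩ → Disjoint (B' ⟨s, hsR⟩).arcs (B' r).arcs := by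
        intro r hr
        rw [hB's, hB'n r hr]
        exact disjoint_insert_left.2 ⟨haB r, hdisj _ _ hr.symm⟩
      intro r t hrt
      by_cases hr : r = ⟨s, hsR⟩
      · subst hr; exact h1 t hrt.symm
      · by_cases ht : t = ⟨s, hsR⟩
        · subst ht; exact (h1 r hr).symm
        · rw [hB'n r hr, hB'n t ht]; exact hdisj r t hrt
    · intro r
      by_cases hr : r = ⟨s, hsR⟩
      · subst hr
        rw [hB's]
        exact disjoint_insert_left.2 ⟨fun h => h.2 rfl, (hU _).mono_right sdiff_subset⟩
      · rw [hB'n r hr]; exact (hU r).mono_right sdiff_subset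
    · intro v hv
      by_cases hva : v = D.head a
      · have : rootsThrough B' v = insert s (rootsThrough B v) := by
          ext r; rw [hmem, mem_insert_iff]; tauto
        rw [this, Matroid.insert_indep_iff]
        exact ⟨hind v hv, fun _ => ⟨hsE, hva ▸ hs⟩⟩
      · have : rootsThrough B' v = rootsThrough B v := by
          ext r; rw [hmem]; tauto
        rw [this]; exact hind v hv
    · intro X hXV
      exact le_cutRank_of_augment haU hsE (fun v r hr => (hmem v r).2 (Or.inl hr))
        ((hmem _ s).2 (Or.inr ⟨rfl, rfl⟩)) (hk X hXV) (hnt X)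
  · push Not at hgood
    refine ⟨B, fun r => (hB r).isArborescence, hdisj, fun v hv => ?_⟩
    refine (hind v hv).isBasis_of_eRk_ge (toFinite _) (hR v) ?_
    have := le_encard_inArcs_add_eRk hF hk (X := univ) (fun a ha _ _ => hgood a ha)
      (mem_univ v) hv
    simpa [inArcs] using this

/-! ### The cut condition -/

/-- The roots of the arborescences through a vertex of `X` that lie outside `X` each contribute an
arc entering `X`. -/
lemma IsMatroidBasedPacking.eRk_le {V R : Set W} {M : Matroid W} {B : R → D.Subdigraph}
    (hB : D.IsMatroidBasedPacking V R M B) {X : Set W} (hX : (X ∩ V).Nonempty) :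
    M.eRk R ≤ D.inDegree X + M.eRk (X ∩ R) := by
  obtain ⟨harb, hdisj, hbas⟩ := hB
  obtain ⟨v, hvX, hvV⟩ := hX
  have hI : M.IsBasis (rootsThrough B v) R := hbas v hvV
  have harc : ∀ r : ↥(rootsThrough B v \ X), ∃ a ∈ (B ⟨r, r.2.1.1⟩).arcs, a ∈ D.inArcs X :=
    fun r => Subdigraph.exists_mem_inArcs
      ((harb ⟨r, r.2.1.1⟩).isOutBranching.reachable v r.2.1.2) r.2.2 hvX
  choose f hfB hfX using harc
  have hf : Function.Injective fun r => (⟨f r, hfX r⟩ : D.inArcs X) := by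
    intro r t hrt
    by_contra hne
    have hrt' : f r = f t := congrArg Subtype.val hrt
    refine (hdisj ⟨r, r.2.1.1⟩ ⟨t, t.2.1.1⟩ fun h => hne (Subtype.ext (Subtype.mk.inj h))).notMem_of_mem_left
      (hfB r) (hrt' ▸ hfB t)
  rw [← hI.encard_eq_eRk, ← encard_sdiff_add_encard_inter (rootsThrough B v) X]
  refine add_le_add (Function.Embedding.encard_le ⟨_, hf⟩) ?_
  exact (hI.indep.subset inter_subset_left).encard_le_eRk_of_subset
    fun r hr => ⟨hr.2, hr.1.1⟩

/-- Among the sets with a given nonempty trace on `V`, the cut condition is tightest for the one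
containing exactly the roots adjacent to that trace: leaving out such a root gains an arc and loses
at most one in rank. -/
lemma eRk_le_of_forall_inNeighbors {V R : Set W} (hdisj : Disjoint V R)
    (hcover : V ∪ R = univ) (hV : ∀ a, D.tail a ≠ D.head a → D.head a ∈ V) {M : Matroid W}
    (h : ∀ X : Set W, (X ∩ V).Nonempty → X ∩ R = D.inNeighbors (X ∩ V) ∩ R →
      M.eRk R ≤ D.inDegree X + M.eRk (X ∩ R)) {X : Set W} (hX : (X ∩ V).Nonempty) :
    M.eRk R ≤ D.inDegree X + M.eRk (X ∩ R) := by
  let N := D.inNeighbors (X ∩ V) ∩ R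
  have hRV : ∀ {x}, x ∈ R → x ∉ V := fun hx => hdisj.notMem_of_mem_right hx
  have hYV : (X ∩ V ∪ N) ∩ V = X ∩ V := by
    ext x
    have := @hRV x
    simp only [N, mem_inter_iff, mem_union]
    tauto
  have hYR : (X ∩ V ∪ N) ∩ R = N := by
    ext x
    have := @hRV x
    simp only [N, mem_inter_iff, mem_union]
    tauto
  have hY := h (X ∩ V ∪ N) (by rwa [hYV]) (by rw [hYV, hYR])
  rw [hYR] at hY
  have hN : M.eRk N ≤ (N \ X).encard + M.eRk (X ∩ R) := by
    refine (M.eRk_mono ?_).trans (M.eRk_union_le_encard_add_eRk (N \ X) (X ∩ R))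
    intro x hx
    by_cases hxX : x ∈ X
    · exact Or.inr ⟨hxX, hx.2⟩
    · exact Or.inl ⟨hx, hxX⟩
  have hd : D.inDegree (X ∩ V ∪ N) + (N \ X).encard ≤ D.inDegree X := by
    let P : Set A := {a | a ∈ D.inArcs X ∧ D.tail a ∈ R}
    have hP : (N \ X).encard ≤ P.encard := by
      refine (encard_le_encard ?_).trans (encard_image_le D.tail P)
      rintro x ⟨⟨⟨-, a, rfl, ha⟩, hxR⟩, hxX⟩
      exact ⟨a, ⟨⟨hxX, ha.1⟩, hxR⟩, rfl⟩
    have hhead : ∀ a ∈ D.inArcs (X ∩ V ∪ N), D.head a ∈ X ∩ V := by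
      rintro a ⟨ht, hh | hh⟩
      · exact hh
      · exact absurd (hV a fun h' => ht (h' ▸ Or.inr hh)) (hRV hh.2)
    have htail : ∀ a ∈ D.inArcs (X ∩ V ∪ N), D.tail a ∉ R := fun a ha hR =>
      ha.1 (Or.inr ⟨⟨fun h' => hRV hR h'.2, a, rfl, hhead a ha⟩, hR⟩)
    refine (add_le_add le_rfl hP).trans ?_
    rw [inDegree, inDegree, ← encard_union_eq]
    · refine encard_le_encard (union_subset ?_ fun a ha => ha.1)
      intro a ha
      have hcov : D.tail a ∈ V ∪ R := hcover ▸ mem_univ _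
      exact ⟨fun h' => ha.1 (Or.inl ⟨h', hcov.resolve_right (htail a ha)⟩), (hhead a ha).1⟩
    · exact disjoint_left.2 fun a ha ha' => htail a ha ha'.2
  calc M.eRk R ≤ D.inDegree (X ∩ V ∪ N) + M.eRk N := hY
    _ ≤ D.inDegree (X ∩ V ∪ N) + ((N \ X).encard + M.eRk (X ∩ R)) := by gcongr
    _ ≤ D.inDegree X + M.eRk (X ∩ R) := by rw [← add_assoc]; gcongr

end MultiDigraph

theorem mainTheorem6 {W A : Type*} [Finite W] [Finite A] (D : MultiDigraph W A)
    (V R : Set W) (hdisj : Disjoint V R) (hcover : V ∪ R = Set.univ)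
    (hR : ∀ r ∈ R, D.IsRoot r) (M : Matroid W) (hM : M.E = R) :
    (∃ B : R → D.Subdigraph, D.IsMatroidBasedPacking V R M B) ↔
      ∀ X : Set W, (X ∩ V).Nonempty → X ∩ R = D.inNeighbors (X ∩ V) ∩ R →
        M.eRk R ≤ D.inDegree X + M.eRk (X ∩ R) := by
  refine ⟨fun ⟨B, hB⟩ X hX _ => hB.eRk_le hX, fun h => ?_⟩
  -- A root may still carry loops, which do not enter it.
  have hV : ∀ a, D.tail a ≠ D.head a → D.head a ∈ V := by
    intro a ha
    have hcov : D.head a ∈ V ∪ R := hcover ▸ Set.mem_univ _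
    refine hcov.resolve_right fun hr => ?_
    have h0 : D.inArcs {D.head a} = ∅ := Set.encard_eq_zero.1 (hR _ hr)
    have : a ∈ D.inArcs {D.head a} := ⟨ha, rfl⟩
    simp [h0] at this
  let B : R → D.Subdigraph := fun r => MultiDigraph.Subdigraph.point D r
  have hB : ∀ v, MultiDigraph.rootsThrough B v = {v} ∩ R := by
    intro v
    ext r
    simp only [MultiDigraph.rootsThrough, B, MultiDigraph.Subdigraph.point, Set.mem_ofPred_eq,
      Set.mem_singleton_iff, exists_prop, Set.mem_inter_iff]
    rw [and_comm, eq_comm]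
  refine MultiDigraph.exists_packing_of_partial hM hV Set.univ B
    (fun r => MultiDigraph.Subdigraph.isOutBranching_point D r) (fun _ _ _ => Set.empty_disjoint _)
    (fun _ => Set.empty_disjoint _) ?_ ?_
  · intro v hv
    have : {v} ∩ R = ∅ := Set.singleton_inter_eq_empty.2 (hdisj.notMem_of_mem_left hv)
    rw [hB, this]
    exact M.empty_indep
  · intro X hX
    have hunion : (⋃ v ∈ X, MultiDigraph.rootsThrough B v) = X ∩ R := by
      ext r
      simp [hB]
    rw [MultiDigraph.cutRank, hunion, Set.inter_univ]
    exact MultiDigraph.eRk_le_of_forall_inNeighbors hdisj hcover hV h hX
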